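/- For $d\ge 1$ let $\mathcal P_d\subset\mathbb R^d$ be the pellytope, i.e. the Newton polytope (the convex hull of the exponent vectors of the monomials that occur) of the polynomial \[ \prod_{i=1}^{d}(1+y_i)\,\prod_{j=1}^{d-1}(1+y_j+y_jy_{j+1})\in\mathbb C[y_1,\dots,y_d], \] and let $\Sigma_d$ be its inner normal fan, i.e. the collection of the cones \[ \{v\in\mathbb R^d : \langle v,x\rangle\le\langle v,y\rangle \text{ for all } x\in F,\ y\in\mathcal P_d\}, \] where $F$ runs over the non-empty faces of $\mathcal P_d$ (including $\mathcal P_d$ itself). Let $e_1,\dots,e_d$ be the standard basis of $\mathbb R^d$, and let the Pell numbers be defined by $n_1=1$, $n_2=2$ and $n_k=2n_{k-1}+n_{k-2}$ for $k\ge 3$. Proposition. For every integer $d\ge 1$, $\Sigma_d$ is a simplicial fan: it is a non-empty finite collection of polyhedral cones, it contains every face of each of its cones, the intersection of any two of its cones is a face of both, and each of its cones is generated by linearly independent vectors. It has exactly $3d-1$ rays (one-dimensional cones), and these are the cones spanned by the $3d-1$ vectors \[ e_1,\dots,e_d,\quad -e_1,\dots,-e_d,\quad e_1-e_2,\ \dots,\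 e_{d-1}-e_d . \] It has exactly $n_{d+1}$ maximal cones (with respect to inclusion). -/

import Mathlib

open scoped Matrix

namespace Pellytope

/-- The Newton polytope of a polynomial `p` in `d` variables: the convex hull in `ℝ^d` of the
exponent vectors of the monomials that occur in `p` with non-zero coefficient. -/
def newtonPolytope {d : ℕ} {K : Type*} [CommSemiring K] (p : MvPolynomial (Fin d) K) :
    Set (Fin d → ℝ) :=
  convexHull ℝ ((fun m : Fin d →₀ ℕ => fun i : Fin d => (m i : ℝ)) '' (p.support : Set _))

/-- The polynomial `∏_{i=1}^d (1 + y_i) · ∏_{j=1}^{d-1} (1 + y_j + y_j y_{j+1})`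
(with variables indexed from `0`). -/
noncomputable def pellyPolynomial (d : ℕ) : MvPolynomial (Fin d) ℂ :=
  (∏ i : Fin d, (1 + MvPolynomial.X i)) *
    ∏ j : Fin (d - 1),
      (1 + MvPolynomial.X ⟨j, by omega⟩
        + MvPolynomial.X ⟨j, by omega⟩ * MvPolynomial.X ⟨j + 1, by omega⟩)

/-- The pellytope `P_d ⊆ ℝ^d`. -/
noncomputable def pellytope (d : ℕ) : Set (Fin d → ℝ) :=
  newtonPolytope (pellyPolynomial d)

/-- The Pell numbers `n_1 = 1`, `n_2 = 2`, `n_k = 2 n_{k-1} + n_{k-2}`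
(and `n_0 = 0`, which is not used). -/
def pellNumber : ℕ → ℕ
  | 0 => 0
  | 1 => 1
  | 2 => 2
  | n + 3 => 2 * pellNumber (n + 2) + pellNumber (n + 1)

/-- The face of `P` on which the linear functional `⟨w, ·⟩` attains its minimum over `P`. -/
def minFace {d : ℕ} (P : Set (Fin d → ℝ)) (w : Fin d → ℝ) : Set (Fin d → ℝ) :=
  {x ∈ P | ∀ y ∈ P, w ⬝ᵥ x ≤ w ⬝ᵥ y}

/-- The inner normal cone of `P` at `F ⊆ P`: all `v` such that `⟨v, ·⟩` attains its minimum over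
`P` at every point of `F`. -/
def innerNormalCone {d : ℕ} (P F : Set (Fin d → ℝ)) : PointedCone ℝ (Fin d → ℝ) where
  carrier := {v | ∀ x ∈ F, ∀ y ∈ P, v ⬝ᵥ x ≤ v ⬝ᵥ y}
  add_mem' := by
    intro a b ha hb x hx y hy
    rw [add_dotProduct, add_dotProduct]
    exact add_le_add (ha x hx y hy) (hb x hx y hy)
  zero_mem' := by
    intro x _ y _
    simp
  smul_mem' := by
    intro c v hv x hx y hy
    have h := mul_le_mul_of_nonneg_left (hv x hx y hy) c.2
    have e : ∀ z : Fin d → ℝ, (c • v) ⬝ᵥ z = (c : ℝ) * (v ⬝ᵥ z) := by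
      intro z
      exact smul_dotProduct (c : ℝ) v z
    rw [e, e]
    exact h

/-- The inner normal fan of a polytope `P`: the inner normal cones of the non-empty faces of `P`
(`P` itself is the face `minFace P 0`). -/
def innerNormalFan {d : ℕ} (P : Set (Fin d → ℝ)) : Set (PointedCone ℝ (Fin d → ℝ)) :=
  {C | ∃ w : Fin d → ℝ, (minFace P w).Nonempty ∧ C = innerNormalCone P (minFace P w)}

/-- A fan in a real vector space: a non-empty finite family of polyhedral (finitely generated)
cones that contains every face of each of its cones, and in which the intersection of any two
cones is a face of both. -/
structure IsFan {E : Type*} [AddCommGroup E] [Module ℝ E] (S : Set (PointedCone ℝ E)) : Prop where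
  nonempty : S.Nonempty
  finite : S.Finite
  polyhedral : ∀ C ∈ S, Submodule.FG C
  face_mem : ∀ C ∈ S, ∀ F : PointedCone ℝ E, F.IsFaceOf C → F ∈ S
  inter_isFaceOf : ∀ C ∈ S, ∀ D ∈ S, (C ⊓ D).IsFaceOf C ∧ (C ⊓ D).IsFaceOf D

/-- A simplicial fan: a fan each of whose cones is generated by linearly independent vectors. -/
structure IsSimplicialFan {E : Type*} [AddCommGroup E] [Module ℝ E]
    (S : Set (PointedCone ℝ E)) : Prop extends IsFan S where
  simplicial : ∀ C ∈ S, C.IsSimplicial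

/-- The rays of a family of cones: its one-dimensional members. -/
def rays {E : Type*} [AddCommGroup E] [Module ℝ E] (S : Set (PointedCone ℝ E)) :
    Set (PointedCone ℝ E) :=
  {C ∈ S | Module.finrank ℝ (Submodule.span ℝ (C : Set E)) = 1}

/-- The members of a family of cones that are maximal with respect to inclusion. -/
def maximalCones {E : Type*} [AddCommGroup E] [Module ℝ E] (S : Set (PointedCone ℝ E)) :
    Set (PointedCone ℝ E) :=
  {C | Maximal (fun D => D ∈ S) C}

/-- The vectors `e_1, …, e_d`, `-e_1, …, -e_d` and `e_1 - e_2, …, e_{d-1} - e_d` of `ℝ^d`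
(with coordinates indexed from `0`). -/
def rayVectors (d : ℕ) : Set (Fin d → ℝ) :=
  Set.range (fun i : Fin d => Pi.single i (1 : ℝ)) ∪
    Set.range (fun i : Fin d => -Pi.single i (1 : ℝ)) ∪
    Set.range (fun j : Fin (d - 1) =>
      Pi.single (⟨j, by omega⟩ : Fin d) (1 : ℝ) - Pi.single (⟨j + 1, by omega⟩ : Fin d) (1 : ℝ))

end Pellytope

/-! The fan is first described by hand and then recognised as the normal fan. Every vector `v` is,
in exactly one way, a non-negative combination of the listed generators supported on a set from
`compatibleSets`. The coefficient of `e_j - e_{j+1}` is the minimum of the positive part of `v_j`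
and the negative part of `v_{j+1}`; what is left of each coordinate goes to `e_i` or `-e_i`.
Existence and uniqueness of such coefficients (`IsConicCoordinates`) already give a simplicial fan
with the stated rays.

The Newton polytope of a product is a Minkowski sum, so its support function is the sum of those of
the factors. Both the order on normal cones and the order on the hand-made cones are governed by
additivity: of the support function in one case, of the coefficients in the other. By
`pellySupport_add_iff` these hold for the same pairs of vectors, so the two fans agree.

A maximal cone is a sign vector with one of two choices at each adjacent pair `+, -`. A transfer
recursion on the first sign counts these and yields the Pell numbers. -/

namespace Pellytope

/-! ### Simplicial fans from unique conic coordinates. -/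

/-- Vectors `r i` and a down-closed family `Δ` of index sets such that every vector is, in exactly
one way, a non-negative combination of the `r i` supported on a member of `Δ`; the coefficients
are given by `c`. -/
structure IsConicCoordinates {ι E : Type*} [Fintype ι] [AddCommGroup E] [Module ℝ E]
    (r : ι → E) (Δ : Set (Set ι)) (c : E → ι → ℝ) : Prop where
  nonneg : ∀ v i, 0 ≤ c v i
  sum_smul : ∀ v, ∑ i, c v i • r i = v
  support_mem : ∀ v, Function.support (c v) ∈ Δ
  eq_of_support_subset : ∀ S ∈ Δ, ∀ a : ι → ℝ, (∀ i, 0 ≤ a i) → Function.support a ⊆ S →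
    c (∑ i, a i • r i) = a
  mem_of_subset : ∀ S ∈ Δ, ∀ T ⊆ S, T ∈ Δ

namespace IsConicCoordinates

variable {ι E : Type*} [Fintype ι] [AddCommGroup E] [Module ℝ E]
  {r : ι → E} {Δ : Set (Set ι)} {c : E → ι → ℝ}

/-- By uniqueness, any non-negative combination supported on `S` displays the coefficients `c v`.
Inclusions, intersections and faces of cones thus reduce to statements about supports. -/
theorem mem_hull_iff (h : IsConicCoordinates r Δ c) {S : Set ι} (hS : S ∈ Δ) (v : E) :
    v ∈ PointedCone.hull ℝ (r '' S) ↔ Function.support (c v) ⊆ S := by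
  constructor
  · intro hv
    suffices H : ∃ a : ι → ℝ, (∀ i, 0 ≤ a i) ∧ Function.support a ⊆ S ∧ ∑ i, a i • r i = v by
      obtain ⟨a, ha, haS, rfl⟩ := H
      rwa [h.eq_of_support_subset S hS a ha haS]
    classical
    induction hv using Submodule.span_induction with
    | mem x hx =>
      obtain ⟨i, hi, rfl⟩ := hx
      refine ⟨Pi.single i 1, fun j => ?_, ?_, ?_⟩
      · by_cases hj : j = i
        · subst hj; simp
        · simp [hj]
      · intro j hj
        by_cases hji : j = i
        · exact hji ▸ hi
        · simp [hji] at hj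
      · simp [Pi.single_apply]
    | zero => exact ⟨0, by simp, by simp, by simp⟩
    | add x y _ _ hx hy =>
      obtain ⟨a, ha, haS, rfl⟩ := hx
      obtain ⟨b, hb, hbS, rfl⟩ := hy
      refine ⟨a + b, fun i => add_nonneg (ha i) (hb i), ?_, ?_⟩
      · exact (Function.support_add a b).trans (Set.union_subset haS hbS)
      · simp [add_smul, Finset.sum_add_distrib]
    | smul t x _ hx =>
      obtain ⟨a, ha, haS, rfl⟩ := hx
      refine ⟨fun i => (t : ℝ) * a i, fun i => mul_nonneg t.2 (ha i), ?_, ?_⟩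
      · intro i hi
        exact haS (right_ne_zero_of_mul hi)
      · rw [Finset.smul_sum]
        exact Finset.sum_congr rfl fun i _ => mul_smul _ _ _
  · intro hv
    rw [← h.sum_smul v]
    refine Submodule.sum_mem _ fun i _ => ?_
    by_cases hi : c v i = 0
    · simp [hi]
    · exact PointedCone.smul_mem _ (h.nonneg v i)
        (PointedCone.subset_hull ⟨i, hv hi, rfl⟩)

theorem coord_add (h : IsConicCoordinates r Δ c) {S : Set ι} (hS : S ∈ Δ) {v w : E}
    (hv : Function.support (c v) ⊆ S) (hw : Function.support (c w) ⊆ S) :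
    c (v + w) = c v + c w := by
  rw [← h.eq_of_support_subset S hS (c v + c w)
    (fun i => add_nonneg (h.nonneg v i) (h.nonneg w i))
    ((Function.support_add _ _).trans (Set.union_subset hv hw))]
  simp [add_smul, Finset.sum_add_distrib, h.sum_smul]

theorem coord_smul (h : IsConicCoordinates r Δ c) {t : ℝ} (ht : 0 ≤ t) (v : E) :
    c (t • v) = t • c v := by
  rw [← h.eq_of_support_subset _ (h.support_mem v) (t • c v)
    (fun i => mul_nonneg ht (h.nonneg v i)) (fun i hi => right_ne_zero_of_mul hi)]
  simp [mul_smul, ← Finset.smul_sum, h.sum_smul]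

theorem coord_single (h : IsConicCoordinates r Δ c) [DecidableEq ι] {i : ι}
    (hi : {i} ∈ Δ) : c (r i) = Pi.single i 1 := by
  rw [← h.eq_of_support_subset {i} hi (Pi.single i 1)]
  · simp [Pi.single_apply]
  · intro j
    by_cases hj : j = i
    · subst hj; simp
    · simp [hj]
  · exact Pi.support_single_subset

theorem hull_le_hull_iff (h : IsConicCoordinates r Δ c) {S T : Set ι} (hS : S ∈ Δ) (hT : T ∈ Δ) :
    PointedCone.hull ℝ (r '' S) ≤ PointedCone.hull ℝ (r '' T) ↔ S ⊆ T := by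
  classical
  refine ⟨fun hle i hi => ?_, fun hST => Submodule.span_mono (Set.image_mono hST)⟩
  have hiΔ : {i} ∈ Δ := h.mem_of_subset S hS _ (by simpa using hi)
  have := (h.mem_hull_iff hT (r i)).1 (hle (PointedCone.subset_hull ⟨i, hi, rfl⟩))
  rw [h.coord_single hiΔ] at this
  exact this (by simp)

theorem injOn_hull (h : IsConicCoordinates r Δ c) :
    Set.InjOn (fun S => PointedCone.hull ℝ (r '' S)) Δ := fun _ hS _ hT hST =>
  ((h.hull_le_hull_iff hS hT).1 hST.le).antisymm ((h.hull_le_hull_iff hT hS).1 hST.ge)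

/-- The positive and negative parts of a linear relation are two non-negative combinations on `S` of
the same vector, so uniqueness makes them equal and the relation trivial. -/
theorem linearIndepOn (h : IsConicCoordinates r Δ c) {S : Set ι} (hS : S ∈ Δ) :
    LinearIndepOn ℝ r S := by
  rw [linearIndepOn_iff]
  intro l hl h0
  rw [Finsupp.mem_supported] at hl
  have hsum : ∑ i, l i • r i = 0 := by
    rw [← h0, Finsupp.linearCombination_apply, Finsupp.sum_fintype _ _ (by simp)]
  have hz : ∀ i, i ∉ S → l i = 0 := fun i hi => by
    by_contra hne
    exact hi (hl (by simpa using hne))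
  have e : ∑ i, (l i)⁺ • r i = ∑ i, (l i)⁻ • r i := by
    rw [← sub_eq_zero, ← Finset.sum_sub_distrib, ← hsum]
    exact Finset.sum_congr rfl fun i _ => by rw [← sub_smul, posPart_sub_negPart]
  have hp := h.eq_of_support_subset S hS (fun i => (l i)⁺) (fun i => posPart_nonneg _)
    (fun i hi => by by_contra hn; simp [hz i hn] at hi)
  have hn := h.eq_of_support_subset S hS (fun i => (l i)⁻) (fun i => negPart_nonneg _)
    (fun i hi => by by_contra hn; simp [hz i hn] at hi)
  rw [e, hn] at hp
  ext i
  rw [← posPart_sub_negPart (l i), ← congrFun hp i]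
  simp

/-- The cones spanned by the members of `Δ`. -/
def fan {ι E : Type*} [AddCommGroup E] [Module ℝ E] (r : ι → E) (Δ : Set (Set ι)) :
    Set (PointedCone ℝ E) :=
  (fun S => PointedCone.hull ℝ (r '' S)) '' Δ

theorem inf_hull (h : IsConicCoordinates r Δ c) {S T : Set ι} (hS : S ∈ Δ) (hT : T ∈ Δ) :
    PointedCone.hull ℝ (r '' S) ⊓ PointedCone.hull ℝ (r '' T) =
      PointedCone.hull ℝ (r '' (S ∩ T)) := by
  ext v
  rw [Submodule.mem_inf, h.mem_hull_iff hS, h.mem_hull_iff hT,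
    h.mem_hull_iff (h.mem_of_subset S hS _ Set.inter_subset_left), Set.subset_inter_iff]

/-- Inside one cone `c` is additive, and non-negative coefficients cannot cancel. -/
theorem isFaceOf_hull (h : IsConicCoordinates r Δ c) {S T : Set ι} (hS : S ∈ Δ) (hTS : T ⊆ S) :
    (PointedCone.hull ℝ (r '' T)).IsFaceOf (PointedCone.hull ℝ (r '' S)) := by
  have hT := h.mem_of_subset S hS T hTS
  refine ⟨(h.hull_le_hull_iff hT hS).2 hTS, ?_⟩
  intro x y a hx hy ha hxy
  rw [h.mem_hull_iff hS] at hx hy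
  rw [h.mem_hull_iff hT] at hxy ⊢
  have hax : Function.support (c (a • x)) ⊆ S := by
    rw [h.coord_smul ha.le]
    exact fun i hi => hx (right_ne_zero_of_mul hi)
  rw [h.coord_add hS hax hy, h.coord_smul ha.le] at hxy
  intro i hi
  refine hxy (ne_of_gt ?_)
  have hpos : 0 < c x i := lt_of_le_of_ne (h.nonneg x i) (Ne.symm hi)
  exact add_pos_of_pos_of_nonneg (mul_pos ha hpos) (h.nonneg y i)

/-- If `v ∈ F` has a positive coefficient at `i`, split off that term: the rest still lies in the
big cone, so the face property puts `r i` in `F`. -/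
theorem eq_hull_of_isFaceOf (h : IsConicCoordinates r Δ c) {S : Set ι} (hS : S ∈ Δ)
    {F : PointedCone ℝ E} (hF : F.IsFaceOf (PointedCone.hull ℝ (r '' S))) :
    F = PointedCone.hull ℝ (r '' {i ∈ S | r i ∈ F}) := by
  classical
  have hT : {i ∈ S | r i ∈ F} ∈ Δ := h.mem_of_subset S hS _ (Set.sep_subset _ _)
  apply le_antisymm
  · intro v hv
    have hvS := (h.mem_hull_iff hS v).1 (hF.le hv)
    rw [h.mem_hull_iff hT]
    intro i hi
    have hpos : 0 < c v i := lt_of_le_of_ne (h.nonneg v i) (Ne.symm hi)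
    refine ⟨hvS hi, hF.mem_of_smul_add_mem (a := c v i)
      (y := ∑ j ∈ Finset.univ.erase i, c v j • r j)
      (PointedCone.subset_hull ⟨i, hvS hi, rfl⟩) ?_ hpos ?_⟩
    · refine Submodule.sum_mem _ fun j _ => ?_
      by_cases hj : c v j = 0
      · simp [hj]
      · exact PointedCone.smul_mem _ (h.nonneg v j) (PointedCone.subset_hull ⟨j, hvS hj, rfl⟩)
    · rwa [Finset.add_sum_erase _ (fun j => c v j • r j) (Finset.mem_univ i), h.sum_smul]
  · refine Submodule.span_le.2 ?_
    rintro _ ⟨i, hi, rfl⟩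
    exact hi.2

theorem isSimplicialFan (h : IsConicCoordinates r Δ c) : IsSimplicialFan (fan r Δ) where
  nonempty := ⟨_, _, h.support_mem 0, rfl⟩
  finite := (Set.toFinite Δ).image _
  polyhedral := by
    rintro _ ⟨S, _, rfl⟩
    exact Submodule.fg_span ((Set.toFinite S).image r)
  face_mem := by
    rintro _ ⟨S, hS, rfl⟩ F hF
    exact ⟨_, h.mem_of_subset S hS _ (Set.sep_subset _ _), (h.eq_hull_of_isFaceOf hS hF).symm⟩
  inter_isFaceOf := by
    rintro _ ⟨S, hS, rfl⟩ _ ⟨T, hT, rfl⟩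
    dsimp only
    rw [h.inf_hull hS hT]
    exact ⟨h.isFaceOf_hull hS Set.inter_subset_left, h.isFaceOf_hull hT Set.inter_subset_right⟩
  simplicial := by
    rintro _ ⟨S, hS, rfl⟩
    exact .hull ((Set.toFinite S).image r) (h.linearIndepOn hS).id_image

theorem finrank_span_hull (h : IsConicCoordinates r Δ c) {S : Set ι} (hS : S ∈ Δ) :
    Module.finrank ℝ (Submodule.span ℝ (PointedCone.hull ℝ (r '' S) : Set E)) = S.ncard := by
  classical
  have e : Submodule.span ℝ (PointedCone.hull ℝ (r '' S) : Set E) = Submodule.span ℝ (r '' S) :=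
    le_antisymm (Submodule.span_le.2 (PointedCone.hull_le_span ℝ (r '' S)))
      (Submodule.span_mono PointedCone.subset_hull)
  have hli := h.linearIndepOn hS
  have hid : LinearIndepOn ℝ id (r '' S) := hli.id_image
  rw [e, finrank_span_set_eq_card hid, ← Set.ncard_eq_toFinset_card', hli.injOn.ncard_image]

theorem rays_fan (h : IsConicCoordinates r Δ c) (hr : ∀ i, {i} ∈ Δ) :
    rays (fan r Δ) = Set.range fun i => PointedCone.hull ℝ {r i} := by
  ext C
  constructor
  · rintro ⟨⟨S, hS, rfl⟩, h1⟩
    rw [h.finrank_span_hull hS, Set.ncard_eq_one] at h1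
    obtain ⟨i, rfl⟩ := h1
    exact ⟨i, by simp⟩
  · rintro ⟨i, rfl⟩
    beta_reduce
    rw [← Set.image_singleton]
    exact ⟨⟨{i}, hr i, rfl⟩, (h.finrank_span_hull (hr i)).trans (Set.ncard_singleton i)⟩

theorem ncard_rays_fan (h : IsConicCoordinates r Δ c) (hr : ∀ i, {i} ∈ Δ) :
    (rays (fan r Δ)).ncard = Fintype.card ι := by
  rw [h.rays_fan hr, ← Set.image_univ, Set.ncard_image_of_injective, Set.ncard_univ,
    Nat.card_eq_fintype_card]
  intro i j hij
  have := h.injOn_hull (hr i) (hr j) (by simpa using hij)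
  simpa using this

theorem ncard_maximalCones_fan (h : IsConicCoordinates r Δ c) :
    (maximalCones (fan r Δ)).ncard = {S | Maximal (· ∈ Δ) S}.ncard := by
  have e : maximalCones (fan r Δ) =
      (fun S => PointedCone.hull ℝ (r '' S)) '' {S | Maximal (· ∈ Δ) S} := by
    ext C
    constructor
    · rintro ⟨⟨S, hS, rfl⟩, hmax⟩
      exact ⟨S, ⟨hS, fun T hT hST => (h.hull_le_hull_iff hT hS).1
        (hmax ⟨T, hT, rfl⟩ ((h.hull_le_hull_iff hS hT).2 hST))⟩, rfl⟩
    · rintro ⟨S, ⟨hS, hmax⟩, rfl⟩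
      refine ⟨⟨S, hS, rfl⟩, ?_⟩
      rintro _ ⟨T, hT, rfl⟩ hST
      exact (h.hull_le_hull_iff hT hS).2 (hmax hT ((h.hull_le_hull_iff hS hT).1 hST))
  rw [e, (h.injOn_hull.mono fun S hS => hS.1).ncard_image]

end IsConicCoordinates

/-! ### Support functions of Newton polytopes. -/

/-- `s` is the minimum of the linear functional `⟨v, ·⟩` over the exponent vectors of `p`. -/
def IsMinExponent {d : ℕ} {K : Type*} [CommSemiring K] (v : Fin d → ℝ) (p : MvPolynomial (Fin d) K)
    (s : ℝ) : Prop :=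
  IsLeast ((fun m : Fin d →₀ ℕ => v ⬝ᵥ fun i => (m i : ℝ)) '' (p.support : Set _)) s

namespace IsMinExponent

variable {d : ℕ} {v : Fin d → ℝ} {p q : MvPolynomial (Fin d) ℕ} {s t : ℝ}

theorem one : IsMinExponent v (1 : MvPolynomial (Fin d) ℕ) 0 := by
  rw [IsMinExponent, MvPolynomial.support_one, Finset.coe_singleton, Set.image_singleton]
  convert! isLeast_singleton
  simp [dotProduct]

theorem X (i : Fin d) : IsMinExponent v (MvPolynomial.X i : MvPolynomial (Fin d) ℕ) (v i) := by
  rw [IsMinExponent, MvPolynomial.support_X, Finset.coe_singleton, Set.image_singleton]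
  convert! isLeast_singleton
  simp [dotProduct, Finsupp.single_apply]

/-- Over `ℕ` coefficients cannot cancel, so supports of sums and products are as large as possible;
`map` then transfers the result to other coefficients. -/
theorem add (hp : IsMinExponent v p s) (hq : IsMinExponent v q t) :
    IsMinExponent v (p + q) (min s t) := by
  have e : (p + q).support = p.support ∪ q.support := by
    ext m
    simp only [MvPolynomial.mem_support_iff, MvPolynomial.coeff_add, Finset.mem_union]
    omega
  rw [IsMinExponent, e, Finset.coe_union, Set.image_union]
  exact hp.union hq

theorem mul (hp : IsMinExponent v p s) (hq : IsMinExponent v q t) :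
    IsMinExponent v (p * q) (s + t) := by
  classical
  have hadd : ∀ m n : Fin d →₀ ℕ, (v ⬝ᵥ fun i => ((m + n) i : ℝ)) =
      (v ⬝ᵥ fun i => (m i : ℝ)) + v ⬝ᵥ fun i => (n i : ℝ) := fun m n => by
    rw [← dotProduct_add]
    congr 1
    ext i
    simp
  obtain ⟨⟨m, hm, rfl⟩, hps⟩ := hp
  obtain ⟨⟨n, hn, rfl⟩, hqt⟩ := hq
  refine ⟨⟨m + n, ?_, hadd m n⟩, ?_⟩
  · rw [Finset.mem_coe, MvPolynomial.mem_support_iff] at hm hn ⊢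
    rw [MvPolynomial.coeff_mul]
    refine (Finset.sum_pos' (fun _ _ => Nat.zero_le _) ⟨(m, n), by simp, ?_⟩).ne'
    exact Nat.pos_of_ne_zero (mul_ne_zero hm hn)
  · rintro _ ⟨k, hk, rfl⟩
    obtain ⟨a, ha, b, hb, rfl⟩ := Finset.mem_add.1 (MvPolynomial.support_mul p q hk)
    beta_reduce
    rw [hadd]
    exact add_le_add (hps ⟨a, ha, rfl⟩) (hqt ⟨b, hb, rfl⟩)

theorem prod {ι : Type*} (S : Finset ι) {f : ι → MvPolynomial (Fin d) ℕ} {g : ι → ℝ}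
    (h : ∀ i ∈ S, IsMinExponent v (f i) (g i)) :
    IsMinExponent v (∏ i ∈ S, f i) (∑ i ∈ S, g i) := by
  classical
  induction S using Finset.induction_on with
  | empty => simpa using one
  | insert a S ha ih =>
    rw [Finset.prod_insert ha, Finset.sum_insert ha]
    exact (h a (by simp)).mul (ih fun i hi => h i (by simp [hi]))

theorem map {K : Type*} [CommSemiring K] {f : ℕ →+* K} (hf : Function.Injective f)
    (hp : IsMinExponent v p s) : IsMinExponent v (p.map f) s := by
  rwa [IsMinExponent, MvPolynomial.support_map_of_injective p hf]

end IsMinExponent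

/-- The support function of the pellytope: the minimum of `⟨v, ·⟩`. -/
noncomputable def pellySupport (d : ℕ) (v : Fin d → ℝ) : ℝ :=
  (∑ i : Fin d, min 0 (v i)) +
    ∑ j : Fin (d - 1), min (min 0 (v ⟨j, by omega⟩)) (v ⟨j, by omega⟩ + v ⟨j + 1, by omega⟩)

theorem isMinExponent_pellyPolynomial (d : ℕ) (v : Fin d → ℝ) :
    IsMinExponent v (pellyPolynomial d) (pellySupport d v) := by
  have e : pellyPolynomial d = MvPolynomial.map (Nat.castRingHom ℂ)
      ((∏ i : Fin d, (1 + MvPolynomial.X i)) *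
        ∏ j : Fin (d - 1), (1 + MvPolynomial.X ⟨j, by omega⟩
          + MvPolynomial.X ⟨j, by omega⟩ * MvPolynomial.X ⟨j + 1, by omega⟩)) := by
    simp [pellyPolynomial, map_prod]
  rw [e]
  refine IsMinExponent.map Nat.cast_injective (.mul (.prod _ fun i _ => ?_) (.prod _ fun j _ => ?_))
  · exact .add .one (.X i)
  · exact .add (.add .one (.X _)) (.mul (.X _) (.X _))

/-! ### Normal cones through additivity of the support function. -/

theorem le_dotProduct_of_mem_convexHull {d : ℕ} {V : Set (Fin d → ℝ)} {v : Fin d → ℝ} {s : ℝ}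
    (hs : IsLeast ((v ⬝ᵥ ·) '' V) s) {x : Fin d → ℝ} (hx : x ∈ convexHull ℝ V) : s ≤ v ⬝ᵥ x := by
  have hconv : Convex ℝ {x : Fin d → ℝ | s ≤ v ⬝ᵥ x} :=
    convex_halfSpace_ge (f := (v ⬝ᵥ ·)) ⟨dotProduct_add v, fun a x => dotProduct_smul a v x⟩ s
  exact convexHull_min (fun y hy => hs.2 ⟨y, hy, rfl⟩) hconv hx

theorem mem_minFace_convexHull_iff {d : ℕ} {V : Set (Fin d → ℝ)} {v : Fin d → ℝ} {s : ℝ}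
    (hs : IsLeast ((v ⬝ᵥ ·) '' V) s) {x : Fin d → ℝ} :
    x ∈ minFace (convexHull ℝ V) v ↔ x ∈ convexHull ℝ V ∧ v ⬝ᵥ x = s := by
  refine and_congr_right fun hx => ⟨fun hmin => ?_, fun hx' y hy => ?_⟩
  · obtain ⟨y, hy, hys⟩ := hs.1
    exact le_antisymm (hys ▸ hmin y (subset_convexHull ℝ V hy))
      (le_dotProduct_of_mem_convexHull hs hx)
  · rw [hx']
    exact le_dotProduct_of_mem_convexHull hs hy

theorem mem_innerNormalCone_minFace_iff {d : ℕ} {P : Set (Fin d → ℝ)} {v w : Fin d → ℝ} :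
    v ∈ innerNormalCone P (minFace P w) ↔ minFace P w ⊆ minFace P v :=
  ⟨fun h x hx => ⟨hx.1, h x hx⟩, fun h _ hx => (h hx).2⟩

/-- `minFace P w ⊆ minFace P v` holds if and only if the support function is additive on
`w = ε v + (w - ε v)` for some `ε > 0`. -/
theorem minFace_convexHull_subset_iff {d : ℕ} {V : Set (Fin d → ℝ)} (hV : V.Finite)
    {h : (Fin d → ℝ) → ℝ} (hh : ∀ v, IsLeast ((v ⬝ᵥ ·) '' V) (h v)) (v w : Fin d → ℝ) :
    minFace (convexHull ℝ V) w ⊆ minFace (convexHull ℝ V) v ↔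
      ∃ ε : ℝ, 0 < ε ∧ h (ε • v + (w - ε • v)) = h (ε • v) + h (w - ε • v) := by
  constructor
  · intro hsub
    -- A point of `V` minimising `w` also minimises `v`, which gives equality for every `ε`. The
    -- other points have strict slack, so by finiteness of `V` one small `ε` serves for all.
    have key : ∀ᶠ ε in nhdsWithin (0 : ℝ) (Set.Ioi 0), ∀ x ∈ V,
        h w - ε * h v ≤ w ⬝ᵥ x - ε * (v ⬝ᵥ x) := by
      rw [Filter.eventually_all_finite hV]
      intro x hx
      have hxP := subset_convexHull ℝ V hx
      rcases ((hh w).2 ⟨x, hx, rfl⟩).eq_or_lt with heq | hlt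
      · have hxv := (mem_minFace_convexHull_iff (hh v)).1
          (hsub ((mem_minFace_convexHull_iff (hh w)).2 ⟨hxP, heq.symm⟩))
        refine Filter.Eventually.of_forall fun ε => ?_
        dsimp only at heq
        rw [hxv.2, heq]
      · have hcont : Continuous fun ε : ℝ => (w ⬝ᵥ x - ε * (v ⬝ᵥ x)) - (h w - ε * h v) := by
          fun_prop
        have hpos := (hcont.continuousAt (x := 0)).eventually
          (lt_mem_nhds (a := 0) (by simpa using hlt))
        filter_upwards [nhdsWithin_le_nhds hpos] with ε hε
        linarith
    obtain ⟨ε, hε, hεpos⟩ := (key.and self_mem_nhdsWithin).exists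
    have hεpos : 0 < ε := hεpos
    refine ⟨ε, hεpos, ?_⟩
    obtain ⟨x, hx, hxe⟩ := (hh (w - ε • v)).1
    obtain ⟨y, hy, hye⟩ := (hh v).1
    obtain ⟨z, hz, hze⟩ := (hh w).1
    have h1 := hε x hx
    have h2 := (hh (ε • v)).2 ⟨y, hy, rfl⟩
    have h3 := (hh (ε • v)).2 ⟨z, hz, rfl⟩
    have h4 := (hh (w - ε • v)).2 ⟨z, hz, rfl⟩
    obtain ⟨u, hu, hue⟩ := (hh (ε • v)).1
    have h5 := mul_le_mul_of_nonneg_left ((hh v).2 ⟨u, hu, rfl⟩) hεpos.le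
    simp only [sub_dotProduct, smul_dotProduct, smul_eq_mul] at *
    rw [add_sub_cancel]
    rw [hye] at h2
    linarith
  · rintro ⟨ε, hε, he⟩ x hx
    rw [add_sub_cancel] at he
    rw [mem_minFace_convexHull_iff (hh _)] at hx ⊢
    refine ⟨hx.1, ?_⟩
    -- On the face of `w` the two lower bounds, for `ε • v` and `w - ε • v`, add up to the actual
    -- value, so both are attained.
    have h1 := le_dotProduct_of_mem_convexHull (hh (w - ε • v)) hx.1
    have h2 := le_dotProduct_of_mem_convexHull (hh v) hx.1
    obtain ⟨y, hy, hye⟩ := (hh v).1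
    have h3 := (hh (ε • v)).2 ⟨y, hy, rfl⟩
    simp only [sub_dotProduct, smul_dotProduct, smul_eq_mul] at *
    rw [hye] at h3
    refine le_antisymm (le_of_mul_le_mul_left ?_ hε) h2
    linarith [hx.2]

/-- The counterpart of `minFace_convexHull_subset_iff` for the coefficients: the inclusion of
supports means that `c w - ε c v` stays non-negative for small `ε > 0`. -/
theorem IsConicCoordinates.support_subset_iff {ι E : Type*} [Fintype ι] [AddCommGroup E]
    [Module ℝ E] {r : ι → E} {Δ : Set (Set ι)} {c : E → ι → ℝ} (hc : IsConicCoordinates r Δ c)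
    (v w : E) : Function.support (c v) ⊆ Function.support (c w) ↔
      ∃ ε : ℝ, 0 < ε ∧ c (ε • v + (w - ε • v)) = c (ε • v) + c (w - ε • v) := by
  constructor
  · intro hsub
    have key : ∀ᶠ ε in nhdsWithin (0 : ℝ) (Set.Ioi 0), ∀ i, 0 ≤ c w i - ε * c v i := by
      rw [Filter.eventually_all]
      intro i
      by_cases hi : c v i = 0
      · exact Filter.Eventually.of_forall fun ε => by simpa [hi] using hc.nonneg w i
      · have hpos : 0 < c w i := lt_of_le_of_ne (hc.nonneg w i) (Ne.symm (hsub hi))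
        have hcont : Continuous fun ε : ℝ => c w i - ε * c v i := by fun_prop
        have := (hcont.continuousAt (x := 0)).eventually
          (lt_mem_nhds (a := 0) (by simpa using hpos))
        filter_upwards [nhdsWithin_le_nhds this] with ε hε using hε.le
    obtain ⟨ε, hε, hεpos⟩ := (key.and self_mem_nhdsWithin).exists
    refine ⟨ε, hεpos, ?_⟩
    have := hc.eq_of_support_subset _ (hc.support_mem w) (fun i => c w i - ε * c v i) hε
      fun i hi hwi => hi (by
        have hvi : c v i = 0 := by_contra fun hvi => hsub hvi hwi
        simp [hwi, hvi])
    simp only [sub_smul, mul_smul, Finset.sum_sub_distrib, ← Finset.smul_sum, hc.sum_smul] at this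
    rw [this, hc.coord_smul (le_of_lt hεpos), add_sub_cancel]
    ext i
    simp
  · rintro ⟨ε, hε, he⟩ i hi
    rw [add_sub_cancel, hc.coord_smul hε.le] at he
    refine ne_of_gt ?_
    rw [he]
    exact add_pos_of_pos_of_nonneg (mul_pos hε (lt_of_le_of_ne (hc.nonneg v i) (Ne.symm hi)))
      (hc.nonneg _ i)

/-- If the support function `h` of a finite set `V` is additive on exactly the pairs of vectors on
which the coefficients `c` are additive, then the inner normal fan of the convex hull of `V`
consists of the cones of `Δ`. -/
theorem innerNormalFan_convexHull_eq_fan {ι : Type*} [Fintype ι] {d : ℕ} {r : ι → Fin d → ℝ}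
    {Δ : Set (Set ι)} {c : (Fin d → ℝ) → ι → ℝ} (hc : IsConicCoordinates r Δ c)
    {V : Set (Fin d → ℝ)} (hV : V.Finite) {h : (Fin d → ℝ) → ℝ}
    (hh : ∀ v, IsLeast ((v ⬝ᵥ ·) '' V) (h v))
    (hadd : ∀ v w, h (v + w) = h v + h w ↔ c (v + w) = c v + c w) :
    innerNormalFan (convexHull ℝ V) = IsConicCoordinates.fan r Δ := by
  classical
  have hcone : ∀ w, innerNormalCone (convexHull ℝ V) (minFace (convexHull ℝ V) w) =
      PointedCone.hull ℝ (r '' Function.support (c w)) := fun w => by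
    ext v
    simp only [mem_innerNormalCone_minFace_iff, hc.mem_hull_iff (hc.support_mem w),
      hc.support_subset_iff, minFace_convexHull_subset_iff hV hh, hadd]
  ext C
  constructor
  · rintro ⟨w, -, rfl⟩
    exact ⟨_, hc.support_mem w, (hcone w).symm⟩
  · rintro ⟨S, hS, rfl⟩
    have hind : Function.support (S.indicator (1 : ι → ℝ)) = S := by
      ext i
      simp
    -- The sum of the generators indexed by `S` lies in the relative interior of their cone: its
    -- coefficients have support exactly `S`.
    refine ⟨∑ i, S.indicator (1 : ι → ℝ) i • r i, ?_, ?_⟩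
    · obtain ⟨x, hx, hxe⟩ := (hh (∑ i, S.indicator (1 : ι → ℝ) i • r i)).1
      exact ⟨x, (mem_minFace_convexHull_iff (hh _)).2 ⟨subset_convexHull ℝ V hx, hxe⟩⟩
    · rw [hcone, hc.eq_of_support_subset S hS _ (fun i => Set.indicator_nonneg (by simp) i)
        hind.subset, hind]

/-! ### The rays, the compatible sets and the coefficients. -/

/-- The index set of the rays: `e_i`, `-e_i` and `e_j - e_{j+1}`. -/
abbrev RayIndex (n : ℕ) : Type := Fin (n + 1) ⊕ Fin (n + 1) ⊕ Fin n

variable {n : ℕ}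

/-- The index of the ray spanned by `e_i`. -/
abbrev posIndex (i : Fin (n + 1)) : RayIndex n := Sum.inl i

/-- The index of the ray spanned by `-e_i`. -/
abbrev negIndex (i : Fin (n + 1)) : RayIndex n := Sum.inr (Sum.inl i)

/-- The index of the ray spanned by `e_j - e_{j+1}`. -/
abbrev descIndex (j : Fin n) : RayIndex n := Sum.inr (Sum.inr j)

/-- The primitive generators of the rays. -/
def rayVector (n : ℕ) : RayIndex n → Fin (n + 1) → ℝ :=
  Sum.elim (fun i => Pi.single i 1)
    (Sum.elim (fun i => -Pi.single i 1) fun j => Pi.single j.castSucc 1 - Pi.single j.succ 1)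

theorem rayVectors_succ (n : ℕ) : rayVectors (n + 1) = Set.range (rayVector n) := by
  rw [rayVector, Set.Sum.elim_range, Set.Sum.elim_range, ← Set.union_assoc]
  rfl

/-- `S` has a ray whose generator is positive in coordinate `k`. -/
def PosAt (S : Set (RayIndex n)) (k : Fin (n + 1)) : Prop :=
  posIndex k ∈ S ∨ ∃ j : Fin n, j.castSucc = k ∧ descIndex j ∈ S

/-- `S` has a ray whose generator is negative in coordinate `k`. -/
def NegAt (S : Set (RayIndex n)) (k : Fin (n + 1)) : Prop :=
  negIndex k ∈ S ∨ ∃ j : Fin n, j.succ = k ∧ descIndex j ∈ S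

/-- The sets of rays that span a cone of the fan: the generators do not have opposite signs in
any coordinate, and `e_j` and `-e_{j+1}` do not both occur. -/
def compatibleSets (n : ℕ) : Set (Set (RayIndex n)) :=
  {S | (∀ k, ¬(PosAt S k ∧ NegAt S k)) ∧
    ∀ j : Fin n, ¬(posIndex j.castSucc ∈ S ∧ negIndex j.succ ∈ S)}

theorem PosAt.mono {S T : Set (RayIndex n)} (hST : S ⊆ T) {k : Fin (n + 1)} (h : PosAt S k) :
    PosAt T k :=
  h.imp (@hST _) fun ⟨j, hj, hjS⟩ => ⟨j, hj, hST hjS⟩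

theorem NegAt.mono {S T : Set (RayIndex n)} (hST : S ⊆ T) {k : Fin (n + 1)} (h : NegAt S k) :
    NegAt T k :=
  h.imp (@hST _) fun ⟨j, hj, hjS⟩ => ⟨j, hj, hST hjS⟩

/-- The coefficient of `e_j - e_{j+1}` in `v`. -/
noncomputable def descCoeff (v : Fin (n + 1) → ℝ) (j : Fin n) : ℝ :=
  min (v j.castSucc)⁺ (v j.succ)⁻

/-- Extends `f` by zero to the last coordinate. -/
def extendLast (f : Fin n → ℝ) : Fin (n + 1) → ℝ := Fin.snoc (α := fun _ => ℝ) f 0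

/-- Shifts `f` by one and extends it by zero to the first coordinate. -/
def shiftFirst (f : Fin n → ℝ) : Fin (n + 1) → ℝ := Fin.cons (α := fun _ => ℝ) 0 f

@[simp] theorem extendLast_castSucc (f : Fin n → ℝ) (j : Fin n) :
    extendLast f j.castSucc = f j := by simp [extendLast]

@[simp] theorem extendLast_last (f : Fin n → ℝ) : extendLast f (Fin.last n) = 0 := by
  simp [extendLast]

@[simp] theorem shiftFirst_succ (f : Fin n → ℝ) (j : Fin n) : shiftFirst f j.succ = f j := by
  simp [shiftFirst]

@[simp] theorem shiftFirst_zero (f : Fin n → ℝ) : shiftFirst f 0 = 0 := by simp [shiftFirst]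

theorem extendLast_add (f g : Fin n → ℝ) : extendLast (f + g) = extendLast f + extendLast g := by
  ext k
  cases k using Fin.lastCases <;> simp

theorem shiftFirst_add (f g : Fin n → ℝ) : shiftFirst (f + g) = shiftFirst f + shiftFirst g := by
  ext k
  cases k using Fin.cases <;> simp

/-- The coefficients of `v` with respect to the rays of the cone that contains it. -/
noncomputable def rayCoeff (v : Fin (n + 1) → ℝ) : RayIndex n → ℝ :=
  Sum.elim (fun i => (v i)⁺ - extendLast (descCoeff v) i)
    (Sum.elim (fun i => (v i)⁻ - shiftFirst (descCoeff v) i) (descCoeff v))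

theorem sum_smul_rayVector (a : RayIndex n → ℝ) (k : Fin (n + 1)) :
    (∑ i, a i • rayVector n i) k =
      (a (posIndex k) + extendLast (fun j => a (descIndex j)) k) -
        (a (negIndex k) + shiftFirst (fun j => a (descIndex j)) k) := by
  have h1 : ∑ j : Fin n, a (descIndex j) * (Pi.single j.castSucc 1 : Fin (n + 1) → ℝ) k =
      extendLast (fun j => a (descIndex j)) k := by
    cases k using Fin.lastCases with
    | last => simp [(Fin.castSucc_ne_last _).symm]
    | cast i => simp [Pi.single_apply]
  have h2 : ∑ j : Fin n, a (descIndex j) * (Pi.single j.succ 1 : Fin (n + 1) → ℝ) k =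
      shiftFirst (fun j => a (descIndex j)) k := by
    cases k using Fin.cases with
    | zero => simp [(Fin.succ_ne_zero _).symm]
    | succ i => simp [Pi.single_apply]
  rw [← h1, ← h2]
  simp only [rayVector, Fintype.sum_sum_type, Finset.sum_apply, Pi.smul_apply,
    Sum.elim_inl, Sum.elim_inr, smul_eq_mul, Pi.sub_apply, Pi.neg_apply, mul_sub,
    Finset.sum_sub_distrib, mul_neg, Finset.sum_neg_distrib]
  have h3 : ∀ b : Fin (n + 1) → ℝ, ∑ i, b i * (Pi.single i 1 : Fin (n + 1) → ℝ) k = b k :=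
    fun b => by simp [Pi.single_apply]
  rw [h3, h3]
  ring

theorem descCoeff_nonneg (v : Fin (n + 1) → ℝ) (j : Fin n) : 0 ≤ descCoeff v j :=
  le_min (posPart_nonneg _) (negPart_nonneg _)

theorem extendLast_descCoeff_le (v : Fin (n + 1) → ℝ) (k : Fin (n + 1)) :
    extendLast (descCoeff v) k ≤ (v k)⁺ := by
  cases k using Fin.lastCases with
  | last => simp
  | cast j => rw [extendLast_castSucc]; exact min_le_left _ _

theorem shiftFirst_descCoeff_le (v : Fin (n + 1) → ℝ) (k : Fin (n + 1)) :
    shiftFirst (descCoeff v) k ≤ (v k)⁻ := by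
  cases k using Fin.cases with
  | zero => simp
  | succ j => rw [shiftFirst_succ]; exact min_le_right _ _

theorem extendLast_nonneg {f : Fin n → ℝ} (hf : ∀ j, 0 ≤ f j) (k : Fin (n + 1)) :
    0 ≤ extendLast f k := by
  cases k using Fin.lastCases <;> simp [hf]

theorem shiftFirst_nonneg {f : Fin n → ℝ} (hf : ∀ j, 0 ≤ f j) (k : Fin (n + 1)) :
    0 ≤ shiftFirst f k := by
  cases k using Fin.cases <;> simp [hf]

theorem posPart_eq_of_eq_sub {x p q : ℝ} (hx : x = p - q) (hp : 0 ≤ p) (hq : 0 ≤ q)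
    (hpq : p = 0 ∨ q = 0) : x⁺ = p ∧ x⁻ = q := by
  rcases hpq with rfl | rfl
  · have : x ≤ 0 := by linarith
    rw [posPart_eq_zero.2 this, negPart_eq_neg.2 this]
    exact ⟨rfl, by linarith⟩
  · have : 0 ≤ x := by linarith
    rw [posPart_eq_self.2 this, negPart_eq_zero.2 this]
    exact ⟨by linarith, rfl⟩

theorem posAt_of_ne_zero {S : Set (RayIndex n)} {a : RayIndex n → ℝ}
    (haS : Function.support a ⊆ S) {k : Fin (n + 1)}
    (hk : a (posIndex k) + extendLast (fun j => a (descIndex j)) k ≠ 0) : PosAt S k := by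
  by_contra hS
  rw [PosAt, not_or] at hS
  have h1 : a (posIndex k) = 0 := by_contra fun h => hS.1 (haS h)
  rw [h1, zero_add] at hk
  cases k using Fin.lastCases with
  | last => simp at hk
  | cast j => exact hS.2 ⟨j, rfl, haS (by simpa using hk)⟩

theorem negAt_of_ne_zero {S : Set (RayIndex n)} {a : RayIndex n → ℝ}
    (haS : Function.support a ⊆ S) {k : Fin (n + 1)}
    (hk : a (negIndex k) + shiftFirst (fun j => a (descIndex j)) k ≠ 0) : NegAt S k := by
  by_contra hS
  rw [NegAt, not_or] at hS
  have h1 : a (negIndex k) = 0 := by_contra fun h => hS.1 (haS h)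
  rw [h1, zero_add] at hk
  cases k using Fin.cases with
  | zero => simp at hk
  | succ j => exact hS.2 ⟨j, rfl, haS (by simpa using hk)⟩

/-- Compatibility excludes cancellation in any coordinate, so the positive and negative parts of `v
k` can be read off from `a`. As `e_j` and `-e_{j+1}` do not both occur, the minimum in `descCoeff`
returns the coefficient of `e_j - e_{j+1}`. -/
theorem rayCoeff_sum_smul {S : Set (RayIndex n)} (hS : S ∈ compatibleSets n)
    {a : RayIndex n → ℝ} (ha : ∀ i, 0 ≤ a i) (haS : Function.support a ⊆ S) :
    rayCoeff (∑ i, a i • rayVector n i) = a := by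
  set v := ∑ i, a i • rayVector n i with hv
  have hpn : ∀ k, (v k)⁺ = a (posIndex k) + extendLast (fun j => a (descIndex j)) k ∧
      (v k)⁻ = a (negIndex k) + shiftFirst (fun j => a (descIndex j)) k := fun k => by
    refine posPart_eq_of_eq_sub (sum_smul_rayVector a k)
      (add_nonneg (ha _) (extendLast_nonneg (fun j => ha _) k))
      (add_nonneg (ha _) (shiftFirst_nonneg (fun j => ha _) k)) ?_
    by_contra! h
    exact hS.1 k ⟨posAt_of_ne_zero haS h.1, negAt_of_ne_zero haS h.2⟩
  have hdesc : descCoeff v = fun j => a (descIndex j) := by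
    ext j
    rw [descCoeff, (hpn _).1, (hpn _).2, extendLast_castSucc, shiftFirst_succ, min_add_add_right]
    have : a (posIndex j.castSucc) = 0 ∨ a (negIndex j.succ) = 0 := by
      by_contra! h
      exact hS.2 j ⟨haS h.1, haS h.2⟩
    rcases this with h | h
    · rw [h, min_eq_left (ha _), zero_add]
    · rw [h, min_eq_right (ha _), zero_add]
  ext i
  rcases i with i | i | j
  · simp only [rayCoeff, Sum.elim_inl, hdesc, (hpn i).1, add_sub_cancel_right]
  · simp only [rayCoeff, Sum.elim_inl, Sum.elim_inr, hdesc, (hpn i).2, add_sub_cancel_right]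
  · simp only [rayCoeff, Sum.elim_inr, hdesc]

/-- A generator in the support has, in each coordinate, the sign of `v` there. Subtracting the
minimum of two numbers from both makes one of them zero, so `e_j` and `-e_{j+1}` are not both used.
-/
theorem support_rayCoeff_mem (v : Fin (n + 1) → ℝ) :
    Function.support (rayCoeff v) ∈ compatibleSets n := by
  have hpos : ∀ k, PosAt (Function.support (rayCoeff v)) k → 0 < v k := by
    intro k hk
    rw [← posPart_pos_iff]
    refine lt_of_le_of_ne (posPart_nonneg _) fun h0 => ?_
    rcases hk with hk | ⟨j, rfl, hj⟩
    · have h1 := extendLast_descCoeff_le v k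
      have h2 := extendLast_nonneg (descCoeff_nonneg v) k
      refine hk ?_
      simp only [rayCoeff, Sum.elim_inl]
      linarith
    · refine hj (le_antisymm ?_ (descCoeff_nonneg v j))
      exact (min_le_left _ _).trans h0.ge
  have hneg : ∀ k, NegAt (Function.support (rayCoeff v)) k → v k < 0 := by
    intro k hk
    rw [← negPart_pos_iff]
    refine lt_of_le_of_ne (negPart_nonneg _) fun h0 => ?_
    rcases hk with hk | ⟨j, rfl, hj⟩
    · have h1 := shiftFirst_descCoeff_le v k
      have h2 := shiftFirst_nonneg (descCoeff_nonneg v) k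
      refine hk ?_
      simp only [rayCoeff, Sum.elim_inl, Sum.elim_inr]
      linarith
    · refine hj (le_antisymm ?_ (descCoeff_nonneg v j))
      exact (min_le_right _ _).trans h0.ge
  refine ⟨fun k hk => lt_asymm (hpos k hk.1) (hneg k hk.2), fun j hj => ?_⟩
  obtain ⟨h1, h2⟩ := hj
  simp only [rayCoeff, Function.mem_support, Sum.elim_inl, Sum.elim_inr, extendLast_castSucc,
    shiftFirst_succ, descCoeff] at h1 h2
  rcases min_choice (v j.castSucc)⁺ (v j.succ)⁻ with h | h
  · exact h1 (by rw [h, sub_self])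
  · exact h2 (by rw [h, sub_self])

theorem isConicCoordinates_rayVector (n : ℕ) :
    IsConicCoordinates (rayVector n) (compatibleSets n) rayCoeff where
  nonneg v i := by
    rcases i with i | i | j
    · exact sub_nonneg.2 (extendLast_descCoeff_le v i)
    · exact sub_nonneg.2 (shiftFirst_descCoeff_le v i)
    · exact descCoeff_nonneg v j
  sum_smul v := by
    ext k
    rw [sum_smul_rayVector]
    simp only [rayCoeff, Sum.elim_inl, Sum.elim_inr, sub_add_cancel]
    exact posPart_sub_negPart (v k)
  support_mem := support_rayCoeff_mem
  eq_of_support_subset _ hS _ ha haS := rayCoeff_sum_smul hS ha haS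
  mem_of_subset S hS T hTS := ⟨fun k hk => hS.1 k ⟨hk.1.mono hTS, hk.2.mono hTS⟩,
    fun j hj => hS.2 j ⟨hTS hj.1, hTS hj.2⟩⟩

theorem singleton_mem_compatibleSets (i : RayIndex n) : {i} ∈ compatibleSets n := by
  refine ⟨fun k => ?_, fun j => ?_⟩
  · rintro ⟨h1 | ⟨j, rfl, h1⟩, h2 | ⟨l, h3, h2⟩⟩
    · exact absurd (h1.trans h2.symm) (by simp)
    · exact absurd (h1.trans h2.symm) (by simp)
    · exact absurd (h1.trans h2.symm) (by simp)
    -- Only `e_j - e_{j+1}` has entries of both signs, and they sit in different coordinates.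
    · have h4 := h1.trans h2.symm
      simp only [Sum.inr.injEq] at h4
      subst h4
      exact (Fin.castSucc_lt_succ (i := j)).ne' h3
  · rintro ⟨h1, h2⟩
    exact absurd (h1.trans h2.symm) (by simp)

/-! ### The support function of the pellytope and its normal fan. -/

theorem min_zero_eq_neg_negPart (x : ℝ) : min 0 x = -x⁻ := by
  rcases le_total 0 x with h | h
  · simp [h]
  · rw [min_eq_right h, negPart_eq_neg.2 h, neg_neg]

/-- This makes the coefficient of `e_j - e_{j+1}` visible in the support function of the factor `1 +
y_j + y_j y_{j+1}`. -/
theorem min_min_zero_add (x y : ℝ) : min (min 0 x) (x + y) = min x⁺ y⁻ - x⁻ - y⁻ := by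
  rcases le_total 0 x with h | h <;> rcases le_total 0 y with h' | h' <;>
    simp only [posPart_eq_self.2, negPart_eq_zero.2, posPart_eq_zero.2, negPart_eq_neg.2, h, h',
      min_def] <;> split_ifs <;> linarith

theorem pellySupport_succ (v : Fin (n + 1) → ℝ) :
    pellySupport (n + 1) v = ∑ i, -(v i)⁻ +
      ∑ j : Fin n, (descCoeff v j - (v j.castSucc)⁻ - (v j.succ)⁻) := by
  refine congrArg₂ (· + ·) ?_ ?_
  · exact Finset.sum_congr rfl fun i _ => min_zero_eq_neg_negPart _
  · exact Finset.sum_congr rfl fun j _ => min_min_zero_add _ _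

/-- Each summand is a minimum of linear functions, hence superadditive, so additivity of the total
forces it termwise. The linear factors give additivity of negative parts, hence of positive parts;
the trinomial factors then give that of `descCoeff`. Conversely, these quantities are recovered
linearly from `rayCoeff`. -/
theorem pellySupport_add_iff (v w : Fin (n + 1) → ℝ) :
    pellySupport (n + 1) (v + w) = pellySupport (n + 1) v + pellySupport (n + 1) w ↔
      rayCoeff (v + w) = rayCoeff v + rayCoeff w := by
  have h1 : ∀ x y : ℝ, -x⁻ + -y⁻ ≤ -(x + y)⁻ := fun x y => by
    simp only [← min_zero_eq_neg_negPart, min_def]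
    split_ifs <;> linarith
  have h2 : ∀ x y z t : ℝ, (min x⁺ y⁻ - x⁻ - y⁻) + (min z⁺ t⁻ - z⁻ - t⁻) ≤
      min (x + z)⁺ (y + t)⁻ - (x + z)⁻ - (y + t)⁻ := fun x y z t => by
    simp only [← min_min_zero_add]
    refine le_min (le_min ?_ ?_) ?_
    · linarith [min_le_left (min 0 x) (x + y), min_le_left 0 x, min_le_left (min 0 z) (z + t),
        min_le_left 0 z]
    · linarith [min_le_left (min 0 x) (x + y), min_le_right 0 x, min_le_left (min 0 z) (z + t),
        min_le_right 0 z]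
    · linarith [min_le_right (min 0 x) (x + y), min_le_right (min 0 z) (z + t)]
  constructor
  · intro h
    have h3 : ∀ i ∈ Finset.univ, -(v i)⁻ + -(w i)⁻ ≤ -((v + w) i)⁻ := fun i _ => h1 _ _
    have h4 : ∀ j ∈ Finset.univ, (descCoeff v j - (v j.castSucc)⁻ - (v j.succ)⁻) +
        (descCoeff w j - (w j.castSucc)⁻ - (w j.succ)⁻) ≤
        descCoeff (v + w) j - ((v + w) j.castSucc)⁻ - ((v + w) j.succ)⁻ := fun j _ => h2 _ _ _ _
    simp only [pellySupport_succ] at h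
    rw [add_add_add_comm, ← Finset.sum_add_distrib, ← Finset.sum_add_distrib, eq_comm,
      add_eq_add_iff_eq_and_eq (Finset.sum_le_sum h3) (Finset.sum_le_sum h4),
      Finset.sum_eq_sum_iff_of_le h3, Finset.sum_eq_sum_iff_of_le h4] at h
    clear h1 h2 h3 h4
    have hneg : ∀ k, ((v + w) k)⁻ = (v k)⁻ + (w k)⁻ := fun k => by
      have := h.1 k (Finset.mem_univ k)
      linarith
    have hpos : ∀ k, ((v + w) k)⁺ = (v k)⁺ + (w k)⁺ := fun k => by
      have := hneg k
      have h3 : _ = v k + w k := posPart_sub_negPart ((v + w) k)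
      have h4 := posPart_sub_negPart (v k)
      have h5 := posPart_sub_negPart (w k)
      linarith
    have hdesc : descCoeff (v + w) = descCoeff v + descCoeff w := by
      ext j
      have h3 := h.2 j (Finset.mem_univ j)
      have h4 := hneg j.castSucc
      have h5 := hneg j.succ
      rw [Pi.add_apply]
      linarith
    ext i
    rcases i with i | i | j
    · simp only [rayCoeff, Sum.elim_inl, Pi.add_apply (f := Sum.elim _ _), hdesc, hpos,
        extendLast_add, Pi.add_apply (f := extendLast _)]
      ring
    · simp only [rayCoeff, Sum.elim_inl, Sum.elim_inr, Pi.add_apply (f := Sum.elim _ _), hdesc,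
        hneg, shiftFirst_add, Pi.add_apply (f := shiftFirst _)]
      ring
    · exact congrFun hdesc j
  · intro h
    have hdesc : descCoeff (v + w) = descCoeff v + descCoeff w :=
      funext fun j => congrFun h (descIndex j)
    have hneg : ∀ k, ((v + w) k)⁻ = (v k)⁻ + (w k)⁻ := fun k => by
      have := congrFun h (negIndex k)
      simp only [rayCoeff, Sum.elim_inl, Sum.elim_inr, Pi.add_apply (f := Sum.elim _ _), hdesc,
        shiftFirst_add, Pi.add_apply (f := shiftFirst _)] at this
      linarith
    simp only [pellySupport_succ, hdesc, hneg, Pi.add_apply (f := descCoeff _)]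
    rw [add_add_add_comm, ← Finset.sum_add_distrib, ← Finset.sum_add_distrib]
    refine congrArg₂ (· + ·) ?_ ?_ <;> exact Finset.sum_congr rfl fun _ _ => by ring

theorem innerNormalFan_pellytope (n : ℕ) :
    innerNormalFan (pellytope (n + 1)) =
      IsConicCoordinates.fan (rayVector n) (compatibleSets n) := by
  refine innerNormalFan_convexHull_eq_fan (isConicCoordinates_rayVector n)
    ((Finset.finite_toSet _).image _) (h := pellySupport (n + 1)) (fun v => ?_)
    pellySupport_add_iff
  have := isMinExponent_pellyPolynomial (n + 1) v
  rwa [IsMinExponent, ← Set.image_image (v ⬝ᵥ ·)] at this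

/-! ### Maximal compatible sets and Pell numbers. -/

/-- The facet of the complex of compatible sets given by a sign vector `s` and, for each `j` with
signs `+, -` at `j, j + 1`, the choice `t j` to drop `e_j` (if true) or `-e_{j+1}` (if false) from
`e_j`, `-e_{j+1}`, `e_j - e_{j+1}`. -/
def facet (s : Fin (n + 1) → Bool) (t : Fin n → Bool) : Set (RayIndex n) :=
  {x | Sum.elim (fun k => s k = true ∧ ∀ j : Fin n, j.castSucc = k → t j = false)
    (Sum.elim (fun k => s k = false ∧ ∀ j : Fin n, j.succ = k → s j.castSucc = true → t j = true)
      fun j => s j.castSucc = true ∧ s j.succ = false) x}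

/-- The choices `t` are made only at the places with signs `+, -`. -/
def IsFacetData (s : Fin (n + 1) → Bool) (t : Fin n → Bool) : Prop :=
  ∀ j, t j = true → s j.castSucc = true ∧ s j.succ = false

theorem posIndex_mem_facet {s : Fin (n + 1) → Bool} {t : Fin n → Bool} {k : Fin (n + 1)} :
    posIndex k ∈ facet s t ↔ s k = true ∧ ∀ j : Fin n, j.castSucc = k → t j = false := Iff.rfl

theorem negIndex_mem_facet {s : Fin (n + 1) → Bool} {t : Fin n → Bool} {k : Fin (n + 1)} :
    negIndex k ∈ facet s t ↔
      s k = false ∧ ∀ j : Fin n, j.succ = k → s j.castSucc = true → t j = true := Iff.rfl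

theorem descIndex_mem_facet {s : Fin (n + 1) → Bool} {t : Fin n → Bool} {j : Fin n} :
    descIndex j ∈ facet s t ↔ s j.castSucc = true ∧ s j.succ = false := Iff.rfl

theorem posAt_facet {s : Fin (n + 1) → Bool} {t : Fin n → Bool} (hst : IsFacetData s t)
    (k : Fin (n + 1)) : PosAt (facet s t) k ↔ s k = true := by
  constructor
  · rintro (h | ⟨j, rfl, h⟩)
    · exact h.1
    · exact h.1
  · intro h
    by_cases ht : ∃ j : Fin n, j.castSucc = k ∧ t j = true
    · obtain ⟨j, rfl, hj⟩ := ht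
      exact Or.inr ⟨j, rfl, hst j hj⟩
    · exact Or.inl ⟨h, fun j hj => by simpa using fun h' => ht ⟨j, hj, h'⟩⟩

theorem negAt_facet {s : Fin (n + 1) → Bool} {t : Fin n → Bool} (k : Fin (n + 1)) :
    NegAt (facet s t) k ↔ s k = false := by
  constructor
  · rintro (h | ⟨j, rfl, h⟩)
    · exact h.1
    · exact h.2
  · intro h
    by_cases ht : ∃ j : Fin n, j.succ = k ∧ s j.castSucc = true ∧ t j = false
    · obtain ⟨j, rfl, hj⟩ := ht
      exact Or.inr ⟨j, rfl, hj.1, h⟩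
    · exact Or.inl ⟨h, fun j hj hs => by simpa using fun h' => ht ⟨j, hj, hs, h'⟩⟩

theorem facet_mem_compatibleSets {s : Fin (n + 1) → Bool} {t : Fin n → Bool}
    (hst : IsFacetData s t) : facet s t ∈ compatibleSets n := by
  refine ⟨fun k hk => ?_, fun j hj => ?_⟩
  · rw [posAt_facet hst, negAt_facet] at hk
    simp [hk.1] at hk
  · have h1 := hj.1.2 j rfl
    have h2 := hj.2.2 j rfl hj.1.1
    simp [h1] at h2

theorem exists_subset_facet {S : Set (RayIndex n)} (hS : S ∈ compatibleSets n) :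
    ∃ s t, IsFacetData s t ∧ S ⊆ facet s t := by
  classical
  have hneg : ∀ k, NegAt S k → ¬PosAt S k := fun k h h' => hS.1 k ⟨h', h⟩
  -- Coordinates in which `S` has no generator get the sign `-`; `e_j` is dropped exactly when `S`
  -- needs `-e_{j+1}` after a `+`.
  refine ⟨fun k => decide (PosAt S k),
    fun j => decide (PosAt S j.castSucc ∧ negIndex j.succ ∈ S), fun j hj => ?_, ?_⟩
  · simp only [decide_eq_true_eq, decide_eq_false_iff_not] at hj ⊢
    exact ⟨hj.1, hneg _ (Or.inl hj.2)⟩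
  · rintro (k | k | j) h
    · rw [posIndex_mem_facet]
      simp only [decide_eq_true_eq, decide_eq_false_iff_not]
      refine ⟨Or.inl h, ?_⟩
      rintro j rfl hj
      exact hS.2 j ⟨h, hj.2⟩
    · rw [negIndex_mem_facet]
      simp only [decide_eq_true_eq, decide_eq_false_iff_not]
      refine ⟨hneg _ (Or.inl h), ?_⟩
      rintro j rfl hj
      exact ⟨hj, h⟩
    · rw [descIndex_mem_facet]
      simp only [decide_eq_true_eq, decide_eq_false_iff_not]
      exact ⟨Or.inr ⟨j, rfl, h⟩, hneg _ (Or.inr ⟨j, rfl, h⟩)⟩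

/-- Every coordinate of a facet carries a definite sign, which inclusion preserves. At a pair `+, -`
the choice is read off from which of `e_j`, `-e_{j+1}` is present; elsewhere it is `false` by
`IsFacetData`. Both maximality and injectivity of the parametrisation follow. -/
theorem eq_of_facet_subset {s s' : Fin (n + 1) → Bool} {t t' : Fin n → Bool}
    (h : IsFacetData s t) (h' : IsFacetData s' t') (hsub : facet s t ⊆ facet s' t') :
    s = s' ∧ t = t' := by
  have hs : s = s' := by
    ext k
    cases hk : s k with
    | true => exact ((posAt_facet h' k).1 (((posAt_facet h k).2 hk).mono hsub)).symm
    | false => exact ((negAt_facet k).1 (((negAt_facet (t := t) k).2 hk).mono hsub)).symm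
  subst hs
  refine ⟨rfl, ?_⟩
  ext j
  cases hj : t j with
  | true =>
    have hmem : negIndex j.succ ∈ facet s t :=
      ⟨(h j hj).2, fun i hi _ => by rwa [Fin.succ_injective _ hi]⟩
    exact ((hsub hmem).2 j rfl (h j hj).1).symm
  | false =>
    by_contra hne
    have hj' : t' j = true := by simpa using Ne.symm hne
    have hmem : posIndex j.castSucc ∈ facet s t :=
      ⟨(h' j hj').1, fun i hi => by rwa [Fin.castSucc_injective _ hi]⟩
    exact hne ((hsub hmem).2 j rfl).symm

theorem maximal_compatibleSets_iff {S : Set (RayIndex n)} :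
    Maximal (· ∈ compatibleSets n) S ↔ ∃ s t, IsFacetData s t ∧ facet s t = S := by
  constructor
  · intro hS
    obtain ⟨s, t, hst, hsub⟩ := exists_subset_facet hS.1
    exact ⟨s, t, hst, (hS.2 (facet_mem_compatibleSets hst) hsub).antisymm hsub⟩
  · rintro ⟨s, t, hst, rfl⟩
    refine ⟨facet_mem_compatibleSets hst, fun T hT hsub => ?_⟩
    obtain ⟨s', t', hst', hT'⟩ := exists_subset_facet hT
    obtain ⟨rfl, rfl⟩ := eq_of_facet_subset hst hst' (hsub.trans hT')
    exact hT'

/-- The number of choices at a pair of adjacent signs. -/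
def descentWeight (a b : Bool) : ℕ := if a = true ∧ b = false then 2 else 1

/-- The number of facets whose first sign is `b`. -/
def facetCount (n : ℕ) (b : Bool) : ℕ :=
  ∑ s : Fin n → Bool, ∏ j : Fin n, descentWeight ((Fin.cons b s : Fin (n + 1) → Bool) j.castSucc)
    ((Fin.cons b s : Fin (n + 1) → Bool) j.succ)

theorem ncard_maximal_compatibleSets_eq_sum (n : ℕ) :
    {S | Maximal (· ∈ compatibleSets n) S}.ncard =
      ∑ s : Fin (n + 1) → Bool, ∏ j : Fin n, descentWeight (s j.castSucc) (s j.succ) := by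
  classical
  let D : Finset ((_ : Fin (n + 1) → Bool) × (Fin n → Bool)) :=
    Finset.univ.sigma fun s => Fintype.piFinset fun j =>
      if s j.castSucc = true ∧ s j.succ = false then Finset.univ else {false}
  have hD : ∀ x, x ∈ D ↔ IsFacetData x.1 x.2 := by
    rintro ⟨s, t⟩
    simp only [D, Finset.mem_sigma, Finset.mem_univ, true_and, Fintype.mem_piFinset, IsFacetData]
    refine forall_congr' fun j => ?_
    split_ifs with h
    · simp [h]
    · simp [h]
  have e : {S | Maximal (· ∈ compatibleSets n) S} =
      (fun x : (_ : Fin (n + 1) → Bool) × (Fin n → Bool) => facet x.1 x.2) '' (D : Set _) := by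
    ext S
    simp only [Set.mem_ofPred_eq, maximal_compatibleSets_iff, Set.mem_image, Finset.mem_coe, hD,
      Sigma.exists]
  have hinj : Set.InjOn (fun x : (_ : Fin (n + 1) → Bool) × (Fin n → Bool) => facet x.1 x.2)
      (D : Set _) := by
    rintro ⟨s, t⟩ hx ⟨s', t'⟩ hy hxy
    obtain ⟨h1, h2⟩ := eq_of_facet_subset ((hD _).1 hx) ((hD _).1 hy) (le_of_eq hxy)
    dsimp only at h1 h2
    rw [h1, h2]
  rw [e, hinj.ncard_image, Set.ncard_coe_finset, Finset.card_sigma]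
  refine Finset.sum_congr rfl fun s _ => ?_
  rw [Fintype.card_piFinset]
  refine Finset.prod_congr rfl fun j _ => ?_
  rw [descentWeight]
  split_ifs <;> simp

theorem sum_cons_bool {M : Type*} [AddCommMonoid M] (f : (Fin (n + 1) → Bool) → M) :
    ∑ s, f s = ∑ s, f (Fin.cons true s) + ∑ s, f (Fin.cons false s) := by
  rw [← (Fin.consEquiv fun _ => Bool).sum_comp, Fintype.sum_prod_type, Fintype.sum_bool]
  rfl

/-- The transfer-matrix step: split by the second sign. -/
theorem facetCount_succ (n : ℕ) (b : Bool) :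
    facetCount (n + 1) b = descentWeight b true * facetCount n true +
      descentWeight b false * facetCount n false := by
  simp only [facetCount, sum_cons_bool (n := n), Fin.prod_univ_succ, Finset.mul_sum]
  rfl

/-- The count for first sign `+` is a difference of Pell numbers, written additively to avoid
subtraction in `ℕ`. Adding the two counts gives the total. -/
theorem facetCount_eq (n : ℕ) :
    facetCount n false = pellNumber (n + 1) ∧
      facetCount n true + pellNumber (n + 1) = pellNumber (n + 2) := by
  induction n with
  | zero => simp [facetCount, pellNumber]
  | succ n ih =>
    have h1 := facetCount_succ n true
    have h2 := facetCount_succ n false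
    have h3 : pellNumber (n + 3) = 2 * pellNumber (n + 2) + pellNumber (n + 1) := rfl
    simp only [descentWeight, reduceCtorEq, and_self, and_true, and_false, if_true, if_false]
      at h1 h2
    constructor <;> simp only [add_assoc, Nat.reduceAdd] at * <;> omega

theorem ncard_maximal_compatibleSets (n : ℕ) :
    {S | Maximal (· ∈ compatibleSets n) S}.ncard = pellNumber (n + 2) := by
  rw [ncard_maximal_compatibleSets_eq_sum, sum_cons_bool, ← (facetCount_eq n).2,
    ← (facetCount_eq n).1]
  rfl

end Pellytope

theorem mainTheorem3 (d : ℕ) (hd : 1 ≤ d) :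
    Pellytope.IsSimplicialFan (Pellytope.innerNormalFan (Pellytope.pellytope d)) ∧
    Pellytope.rays (Pellytope.innerNormalFan (Pellytope.pellytope d)) =
      (fun v => PointedCone.hull ℝ {v}) '' Pellytope.rayVectors d ∧
    (Pellytope.rays (Pellytope.innerNormalFan (Pellytope.pellytope d))).ncard = 3 * d - 1 ∧
    (Pellytope.maximalCones (Pellytope.innerNormalFan (Pellytope.pellytope d))).ncard =
      Pellytope.pellNumber (d + 1) := by
  obtain ⟨n, rfl⟩ : ∃ n, d = n + 1 := ⟨d - 1, by omega⟩
  have h := Pellytope.isConicCoordinates_rayVector n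
  rw [Pellytope.innerNormalFan_pellytope]
  refine ⟨h.isSimplicialFan, ?_, ?_, ?_⟩
  · rw [h.rays_fan Pellytope.singleton_mem_compatibleSets, Pellytope.rayVectors_succ,
      ← Set.range_comp]
    rfl
  · rw [h.ncard_rays_fan Pellytope.singleton_mem_compatibleSets]
    simp only [Fintype.card_sum, Fintype.card_fin]
    omega
  · rw [h.ncard_maximalCones_fan, Pellytope.ncard_maximal_compatibleSets]
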